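/- Let $\mathcal{L}at$ be the variety of lattices, in the signature with two binary operation symbols $\wedge,\vee$ (and no constants). Then: 1. $\mathcal{L}at$ is not coherent: there are a finitely presented lattice $\mathbf{B}$ and a finitely generated sublattice $\mathbf{A}$ of $\mathbf{B}$ such that $\mathbf{A}$ is not finitely presented. (A lattice is finitely presented if it is presented, within the variety of lattices, by finitely many generators and finitely many relations.) 2. $\mathcal{L}at$ does not admit (right) uniform deductive interpolation: it is not the case that for all disjoint finite sets of variables $\bar{x},\bar{y}$ and every finite set $\Sigma(\bar{x},\bar{y})$ of equations between lattice terms there is a finite set $\Pi(\bar{y})$ of equations such that, for every set of variables $\bar{z}$ disjoint from $\bar{x},\bar{y}$ and every equation $\varepsilon(\bar{y},\bar{z})$, $$\Sigma\models_{\mathcal{L}at}\varepsilon\iff\Pi\models_{\mathcal{L}at}\varepsilon .$$ Here $\Sigma\models_{\mathcal{L}at}\varepsilon$ means that, in every lattice, every assignment of the variables that satisfies all equations of $\Sigma$ also satisfies $\varepsilon$. 3. The first-order theory $T$ of $\mathcal{L}at$, i.e. the set of all first-order sentences in the signature $\{\wedge,\vee\}$ that are true in all non-empty lattices, has no model completion: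 there is no theory $T^*$ in the same signature such that every model of $T^*$ is a model of $T$, every model of $T$ embeds into a model of $T^*$, and for every model $\mathbf{M}$ of $T$ the theory $T^*$ together with the diagram of $\mathbf{M}$ is complete (equivalently, whenever $\mathbf{M}$ embeds into models $\mathbf{N}_1,\mathbf{N}_2$ of $T^*$, these satisfy the same first-order formulas with parameters from $\mathbf{M}$). -/

import Mathlib

universe u

namespace UniversalAlgebra

open FirstOrder FirstOrder.Language

/-- An equation `s ≈ t` between `L`-terms with variables in `α`. -/
abbrev Equation (L : FirstOrder.Language.{0, 0}) (α : Type) : Type := L.Term α × L.Term α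

namespace Equation

variable {L : FirstOrder.Language.{0, 0}} {α β : Type}

/-- The equation `e` is satisfied in the algebra `A` under the assignment `v`. -/
def Holds (e : Equation L α) {A : Type u} [L.Structure A] (v : α → A) : Prop :=
  e.1.realize v = e.2.realize v

/-- Renaming of the variables of an equation. -/
def rename (f : α → β) (e : Equation L α) : Equation L β :=
  (e.1.relabel f, e.2.relabel f)

end Equation

/-- An equationally defined class (variety), given by a set of defining identities in countably
many variables. -/
abbrev Variety (L : FirstOrder.Language.{0, 0}) : Type := Set (Equation L ℕ)

namespace Variety

variable {L : FirstOrder.Language.{0, 0}}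

/-- `A` belongs to `V`: every defining identity of `V` holds in `A` under every assignment. -/
def IsMember (V : Variety L) (A : Type u) [L.Structure A] : Prop :=
  ∀ e ∈ V, ∀ v : ℕ → A, e.Holds v

/-- Equational consequence `S ⊨_V e`: every assignment into a member of `V` which satisfies all
equations of `S` also satisfies `e`. -/
def Entails (V : Variety L) {α : Type} (S : Set (Equation L α)) (e : Equation L α) : Prop :=
  ∀ (A : Type u) [L.Structure A], V.IsMember A → ∀ v : α → A, (∀ d ∈ S, d.Holds v) → e.Holds v

/-- `A` is the member of `V` presented by the generators `a i` and the relations `R`: it lies in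
`V`, is generated by the `a i`, these satisfy `R`, and every family in a member of `V` which
satisfies `R` is the image of `a` under a homomorphism. Thus `A ≅ F(α) / Cg(R)`. -/
structure IsPresentedBy (V : Variety L) (A : Type u) [L.Structure A] {α : Type}
    (a : α → A) (R : Set (Equation L α)) : Prop where
  mem : V.IsMember A
  generates : Substructure.closure L (Set.range a) = ⊤
  holds : ∀ e ∈ R, e.Holds a
  lift : ∀ (B : Type u) [L.Structure B], V.IsMember B → ∀ b : α → B, (∀ e ∈ R, e.Holds b) →
    ∃ f : A →[L] B, ∀ i, f (a i) = b i

/-- `A` is a finitely presented member of `V`. -/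
def IsFinitelyPresented (V : Variety L) (A : Type u) [L.Structure A] : Prop :=
  ∃ (n : ℕ) (a : Fin n → A) (R : Set (Equation L (Fin n))), R.Finite ∧ V.IsPresentedBy A a R

/-- `V` is coherent: finitely generated subalgebras of finitely presented members of `V` are
finitely presented. -/
def IsCoherent (V : Variety L) : Prop :=
  ∀ (B : Type u) [L.Structure B], V.IsFinitelyPresented B →
    ∀ S : L.Substructure B, S.FG → V.IsFinitelyPresented S

/-- (Right) uniform deductive interpolation: for all finite `x`, `y` and every finite set
`S(x, y)` of equations there is a finite set `P(y)` of equations such that for every equation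
`e(y, z)`, `S ⊨_V e` if and only if `P ⊨_V e`. Disjoint unions of sets of variables are sum
types, and the renamings are the inclusions of variables. -/
def HasUniformDeductiveInterpolation (V : Variety L) : Prop :=
  ∀ (x y : Type) [Finite x] [Finite y] (S : Set (Equation L (x ⊕ y))), S.Finite →
    ∃ P : Set (Equation L y), P.Finite ∧
      ∀ (z : Type) (e : Equation L (y ⊕ z)),
        Entails.{u} V (Equation.rename (Sum.map id Sum.inl : x ⊕ y → x ⊕ (y ⊕ z)) '' S)
            (e.rename (Sum.inr : y ⊕ z → x ⊕ (y ⊕ z))) ↔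
          Entails.{u} V (Equation.rename (Sum.inl : y → y ⊕ z) '' P) e

/-- The first-order theory of `V`: all sentences true in all (non-empty) members of `V`. -/
def firstOrderTheory (V : Variety L) : L.Theory :=
  {φ | ∀ (A : Type u) [L.Structure A] [Nonempty A], V.IsMember A → A ⊨ φ}

end Variety

/-- `T'` is a model completion of `T`: `T'` extends `T`, every model of `T` embeds into a model of
`T'`, and for every model `M` of `T` the theory `T'` together with the diagram of `M` is complete,
i.e. any two models of `T'` extending `M` satisfy the same first-order formulas with parameters
from `M`. -/
structure IsModelCompletion {L : FirstOrder.Language.{0, 0}} (T T' : L.Theory) : Prop where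
  extend : ∀ φ ∈ T, T' ⊨ᵇ φ
  embed : ∀ M : Theory.ModelType.{0, 0, u} T, ∃ N : Theory.ModelType.{0, 0, u} T',
    Nonempty (M ↪[L] N)
  complete : ∀ (M : Theory.ModelType.{0, 0, u} T) (N₁ N₂ : Theory.ModelType.{0, 0, u} T')
    (f₁ : M ↪[L] N₁) (f₂ : M ↪[L] N₂) (n : ℕ) (φ : L.Formula (Fin n)) (v : Fin n → M),
    φ.Realize (f₁ ∘ v) ↔ φ.Realize (f₂ ∘ v)

/-- The operation symbols of lattices. -/
inductive LatticeOp : ℕ → Type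
  | meet : LatticeOp 2
  | join : LatticeOp 2

/-- The first-order language of lattices: two binary operation symbols and no relation symbols. -/
def latticeLanguage : FirstOrder.Language.{0, 0} := ⟨LatticeOp, fun _ => Empty⟩

/-- The meet symbol. -/
abbrev meetSymb : latticeLanguage.Functions 2 := LatticeOp.meet

/-- The join symbol. -/
abbrev joinSymb : latticeLanguage.Functions 2 := LatticeOp.join

/-- The term `s ∧ t`. -/
def meet {α : Type} (s t : latticeLanguage.Term α) : latticeLanguage.Term α :=
  meetSymb.apply₂ s t

/-- The term `s ∨ t`. -/
def join {α : Type} (s t : latticeLanguage.Term α) : latticeLanguage.Term α :=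
  joinSymb.apply₂ s t

/-- The variety of lattices: commutativity, associativity and absorption. -/
def lattices : Variety latticeLanguage :=
  let x : latticeLanguage.Term ℕ := Term.var 0
  let y : latticeLanguage.Term ℕ := Term.var 1
  let z : latticeLanguage.Term ℕ := Term.var 2
  {(meet x y, meet y x), (join x y, join y x),
    (meet (meet x y) z, meet x (meet y z)), (join (join x y) z, join x (join y z)),
    (meet x (join x y), x), (join x (meet x y), x)}

end UniversalAlgebra

/-! Put `t(p) = p ∨ (a ∧ (b ∨ (c ∧ (d ∨ p))))` and consider the finite system `x ≤ p ≤ y`, `t(p) =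
p` with unknown `p` and six parameters. It is solvable in some extension of a given lattice exactly
when `tⁿ(x) ≤ y` for all `n`. Necessity is monotonicity of `t`
(`iterateBound_of_fixpointEquations`). Conversely, the ideal generated by the iterates solves the
system in the ideal lattice (`exists_fixpoint_extension`).

These infinitely many bounds do not follow from finitely many consequences of the system. Among the
subgroups of `ℚ × ℚ` there are parameters whose iterates increase strictly
(`exists_bounded_iterates`); taking `y` to be the `k`-th iterate, the bounds hold up to `k` and fail
at `k + 1`. In a nonprincipal ultrapower all bounds hold, so the system is solvable in an extension,
every consequence holds there, and finitely many of them already hold at some index `k`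
(`exists_not_iterateBound`).

A finite presentation of the sublattice generated by the parameters, or a finite uniform
interpolant, would be such a finite set of consequences. A model completion would pull a solution
back from the extension into the ultrapower itself, hence into a factor where a bound fails. -/

namespace UniversalAlgebra

open FirstOrder FirstOrder.Language FirstOrder.Language.Structure

/-! ### Equations under maps and in ultraproducts -/

namespace Equation

variable {L : FirstOrder.Language.{0, 0}} {α β : Type}

theorem holds_rename (e : Equation L α) (f : α → β) {A : Type*} [L.Structure A] (v : β → A) :
    (e.rename f).Holds v ↔ e.Holds (v ∘ f) := by
  simp [Holds, rename]

theorem Holds.map {e : Equation L α} {A B : Type*} [L.Structure A] [L.Structure B] {v : α → A}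
    (h : e.Holds v) (f : A →[L] B) : e.Holds (f ∘ v) := by
  simp only [Holds, HomClass.realize_term] at h ⊢
  rw [h]

theorem holds_embedding (e : Equation L α) {A B : Type*} [L.Structure A] [L.Structure B]
    (f : A ↪[L] B) (v : α → A) : e.Holds (f ∘ v) ↔ e.Holds v := by
  simp only [Holds, HomClass.realize_term]
  exact f.injective.eq_iff

/-- The class of a family in an ultraproduct. -/
def productMk {ι : Type} (U : Ultrafilter ι) {M : ι → Type u} (v : ∀ i, M i) :
    (U : Filter ι).Product M := (v : (U : Filter ι).Product M)

theorem productMk_surjective {ι : Type} (U : Ultrafilter ι) {M : ι → Type u} :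
    Function.Surjective (productMk U (M := M)) :=
  Quotient.exists_rep

/-- Łoś's theorem for equations: terms are evaluated coordinatewise. -/
theorem holds_ultraproduct {ι : Type} (U : Ultrafilter ι) (e : Equation L α) {M : ι → Type u}
    [∀ i, L.Structure (M i)] [∀ i, Nonempty (M i)] (v : α → ∀ i, M i) :
    e.Holds (fun a => productMk U (v a)) ↔ ∀ᶠ i in U, e.Holds fun a => v a i := by
  have h (t : L.Term α) : t.realize (fun a => productMk U (v a)) =
      productMk U fun i => t.realize fun a => v a i := Ultraproduct.term_realize_cast v t
  unfold Holds
  rw [h, h]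
  exact Quotient.eq (r := (U : Filter ι).productSetoid M)

end Equation

namespace Variety

variable {L : FirstOrder.Language.{0, 0}} (V : Variety L)

theorem IsMember.ultraproduct {V : Variety L} {ι : Type} (U : Ultrafilter ι) {M : ι → Type u}
    [∀ i, L.Structure (M i)] [∀ i, Nonempty (M i)] (hM : ∀ i, V.IsMember (M i)) :
    V.IsMember ((U : Filter ι).Product M) := by
  intro e he v
  choose g hg using fun a => Equation.productMk_surjective U (v a)
  obtain rfl : (fun a => Equation.productMk U (g a)) = v := funext hg
  exact (Equation.holds_ultraproduct U e g).2 (Filter.Eventually.of_forall fun i => hM i e he _)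

/-! ### Algebras given by generators and relations -/

section Presentation

variable {α : Type} (R : Set (Equation L α))

/-- Terms, lifted to the universe `u`, modulo the consequences of `R` in `V`. -/
def entailsSetoid : Setoid (ULift.{u} (L.Term α)) where
  r s t := Entails.{u} V R (s.down, t.down)
  iseqv :=
    ⟨fun _ _ _ _ _ _ => rfl, fun h A _ hA v hv => (h A hA v hv).symm,
      fun h h' A _ hA v hv => (h A hA v hv).trans (h' A hA v hv)⟩

instance entailsPrestructure : L.Prestructure (entailsSetoid.{u} V R) where
  toStructure :=
    { funMap := fun f x => ⟨Term.func f fun i => (x i).down⟩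
      RelMap := fun _ _ => False }
  fun_equiv := fun {n f} x y h A _ hA v hv => by
    simp only [Equation.Holds, Term.realize_func]
    exact congrArg _ (funext fun i => h i A hA v hv)
  rel_equiv := fun _ _ _ => rfl

/-- The algebra presented by the relations `R`. -/
abbrev Presented : Type u := Quotient (entailsSetoid.{u} V R)

/-- The class of a term in the presented algebra. -/
def Presented.mk (t : L.Term α) : Presented.{u} V R := Quotient.mk _ ⟨t⟩

variable {V R}

theorem Presented.mk_eq_mk {s t : L.Term α} :
    Presented.mk.{u} V R s = Presented.mk V R t ↔ Entails.{u} V R (s, t) :=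
  Quotient.eq (r := entailsSetoid.{u} V R)

theorem Presented.funMap_mk {n : ℕ} (f : L.Functions n) (g : Fin n → L.Term α) :
    (funMap f fun i => Presented.mk.{u} V R (g i)) = Presented.mk V R (Term.func f g) :=
  funMap_quotient_mk' (entailsSetoid.{u} V R) f fun i => ⟨g i⟩

theorem Presented.realize_mk {β : Type} (t : L.Term β) (g : β → L.Term α) :
    t.realize (fun i => Presented.mk.{u} V R (g i)) = Presented.mk V R (t.subst g) := by
  induction t with
  | var => rfl
  | func f ts ih => simp only [Term.realize_func, ih, Presented.funMap_mk, Term.subst]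

theorem Presented.realize_var (t : L.Term α) :
    t.realize (fun i => Presented.mk.{u} V R (Term.var i)) = Presented.mk V R t := by
  induction t with
  | var => rfl
  | func f ts ih => simp only [Term.realize_func, ih, Presented.funMap_mk]

theorem Presented.mk_surjective : Function.Surjective (Presented.mk.{u} V R) := by
  rintro ⟨t⟩
  exact ⟨t.down, rfl⟩

variable (V R)

theorem Presented.isPresentedBy :
    V.IsPresentedBy (Presented.{u} V R) (fun i => Presented.mk V R (Term.var i)) R where
  mem e he v := by
    choose g hg using fun i => Presented.mk_surjective (v i)
    obtain rfl : (fun i => Presented.mk V R (g i)) = v := funext hg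
    simp only [Equation.Holds, Presented.realize_mk, Presented.mk_eq_mk]
    intro A _ hA w _
    simp only [Equation.Holds, Term.realize_subst]
    exact hA e he _
  generates := by
    refine eq_top_iff.2 fun x _ => ?_
    obtain ⟨t, rfl⟩ := Presented.mk_surjective x
    rw [← Presented.realize_var]
    exact Term.realize_mem _ _ fun i => Substructure.subset_closure ⟨i, rfl⟩
  holds e he := by
    simp only [Equation.Holds, Presented.realize_var, Presented.mk_eq_mk]
    intro A _ hA w hw
    exact hw e he
  lift B _ hB b hb := by
    refine ⟨{ toFun := Quotient.lift (fun t : ULift.{u} (L.Term α) => t.down.realize b)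
                fun s t h => h B hB b hb
              map_fun' := ?_
              map_rel' := ?_ }, fun i => rfl⟩
    · intro n f x
      choose g hg using fun i => Presented.mk_surjective (x i)
      obtain rfl : (fun i => Presented.mk V R (g i)) = x := funext hg
      rw [Presented.funMap_mk]
      rfl
    · intro n r x h
      choose g hg using fun i => Presented.mk_surjective (x i)
      obtain rfl : (fun i => Presented.mk V R (g i)) = x := funext hg
      exact ((relMap_quotient_mk' (entailsSetoid.{u} V R) r fun i => ⟨g i⟩).1 h).elim

theorem IsPresentedBy.isFinitelyPresented {V : Variety L} {A : Type u} [L.Structure A] [Finite α]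
    {a : α → A} {R : Set (Equation L α)} (hR : R.Finite) (h : V.IsPresentedBy A a R) :
    V.IsFinitelyPresented A := by
  obtain ⟨n, ⟨ε⟩⟩ := Finite.exists_equiv_fin α
  refine ⟨n, a ∘ ε.symm, Equation.rename ε '' R, hR.image _, h.mem, ?_, ?_, ?_⟩
  · rw [ε.symm.surjective.range_comp, h.generates]
  · rintro _ ⟨e, he, rfl⟩
    rw [Equation.holds_rename, Function.comp_assoc, ε.symm_comp_self]
    exact h.holds e he
  · intro B _ hB b hb
    obtain ⟨f, hf⟩ := h.lift B hB (b ∘ ε) fun e he =>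
      (e.holds_rename ε b).1 (hb _ ⟨e, he, rfl⟩)
    exact ⟨f, fun i => by simp [hf]⟩

end Presentation

/-- Realization of terms over a generating family is onto. -/
theorem exists_realize_eq_of_mem_closure {A : Type*} [L.Structure A] {α : Type} (a : α → A) {x : A}
    (hx : x ∈ Substructure.closure L (Set.range a)) : ∃ t : L.Term α, t.realize a = x := by
  obtain ⟨t, rfl⟩ := Substructure.mem_closure_iff_exists_term.1 hx
  choose g hg using fun i : Set.range a => i.2
  refine ⟨t.relabel g, ?_⟩
  rw [Term.realize_relabel]
  exact congrArg (fun v => t.realize v) (funext hg)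

/-- A finitely presented algebra has, over
any finite generating family `b`, a finite set of relations `E` which hold at `b` and such that
every relation that holds at `b` follows from `E`. -/
theorem IsFinitelyPresented.exists_relations {V : Variety L} {A : Type u} [L.Structure A]
    (hA : V.IsFinitelyPresented A) {β : Type} [Finite β] (b : β → A)
    (hb : Substructure.closure L (Set.range b) = ⊤) :
    ∃ E : Set (Equation L β), E.Finite ∧ (∀ e ∈ E, e.Holds b) ∧
      ∀ e : Equation L β, e.Holds b → Entails.{u} V E e := by
  obtain ⟨n, a, R, hR, h⟩ := hA
  choose p hp using fun i => exists_realize_eq_of_mem_closure b (x := a i) (by rw [hb]; trivial)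
  choose q hq using fun j => exists_realize_eq_of_mem_closure a (x := b j) 
    (by rw [h.generates]; trivial)
  -- Tietze transformation: the old relations with each old generator written as a term in `b`,
  -- together with equations recovering each `b j` from these terms.
  refine ⟨(fun e : Equation L (Fin n) => (e.1.subst p, e.2.subst p)) '' R ∪
    Set.range fun j => ((q j).subst p, Term.var j), (hR.image _).union (Set.finite_range _),
    ?_, ?_⟩
  · rintro _ (⟨e, he, rfl⟩ | ⟨j, rfl⟩)
    · simp only [Equation.Holds, Term.realize_subst, hp]
      exact h.holds e he
    · simp only [Equation.Holds, Term.realize_subst, hp, Term.realize_var]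
      exact hq j
  · intro e he B _ hB v hv
    obtain ⟨f, hf⟩ := h.lift B hB (fun i => (p i).realize v) fun d hd => by
      simpa only [Equation.Holds, Term.realize_subst] using hv _ (Or.inl ⟨d, hd, rfl⟩)
    have hfb : f ∘ b = v := by
      funext j
      have h1 := hv _ (Or.inr ⟨j, rfl⟩)
      simp only [Equation.Holds, Term.realize_subst, Term.realize_var] at h1
      rw [← h1, Function.comp_apply, ← hq, ← HomClass.realize_term]
      exact congrArg (fun w => (q j).realize w) (funext hf)
    rw [← hfb]
    exact he.map f

end Variety

/-! ### Lattices as structures -/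

/-- A lattice as a structure of the language of lattices. -/
abbrev latticeStructure (A : Type*) [Lattice A] : latticeLanguage.Structure A where
  funMap {n} f :=
    match n, f with
    | _, LatticeOp.meet => fun v => v 0 ⊓ v 1
    | _, LatticeOp.join => fun v => v 0 ⊔ v 1
  RelMap r := r.elim

section Realize

attribute [local instance] latticeStructure

variable {A : Type*} [Lattice A] {α : Type}

theorem realize_meet (s t : latticeLanguage.Term α) (v : α → A) :
    (meet s t).realize v = s.realize v ⊓ t.realize v := rfl

theorem realize_join (s t : latticeLanguage.Term α) (v : α → A) :
    (join s t).realize v = s.realize v ⊔ t.realize v := rfl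

theorem isMember_lattices (A : Type*) [Lattice A] : lattices.IsMember A := by
  rintro e he v
  simp only [lattices, Set.mem_insert_iff, Set.mem_singleton_iff] at he
  rcases he with rfl | rfl | rfl | rfl | rfl | rfl <;>
    simp only [Equation.Holds, realize_meet, realize_join, Term.realize_var]
  · exact inf_comm _ _
  · exact sup_comm _ _
  · exact inf_assoc _ _ _
  · exact sup_assoc _ _ _
  · exact inf_sup_self
  · exact sup_inf_self

/-- An injective lattice homomorphism is an embedding of structures. -/
def embeddingOfLatticeHom {B : Type*} [Lattice B] (f : LatticeHom A B)
    (hf : Function.Injective f) : A ↪[latticeLanguage] B where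
  toFun := f
  inj' := hf
  map_fun' {n} g x := by
    cases g
    · exact map_inf f _ _
    · exact map_sup f _ _
  map_rel' r := r.elim

end Realize

/-- Every member of the variety of lattices comes from a lattice. -/
theorem exists_lattice_of_isMember {A : Type*} [S : latticeLanguage.Structure A]
    (h : lattices.IsMember A) : ∃ _ : Lattice A, S = latticeStructure A := by
  -- The identities involve only the variables `0`, `1`, `2`, so these assignments capture them.
  have hm (e) (he : e ∈ lattices) (a b c : A) :
      e.Holds (fun n : ℕ => if n = 0 then a else if n = 1 then b else c) := h e he _
  simp only [lattices, Set.mem_insert_iff, Set.mem_singleton_iff, forall_eq_or_imp, forall_eq,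
    Equation.Holds, meet, join, Term.realize_functions_apply₂, Term.realize_var] at hm
  simp only [if_true, one_ne_zero, if_false, OfNat.ofNat_ne_zero, OfNat.ofNat_ne_one] at hm
  obtain ⟨h1, h2, h3, h4, h5, h6⟩ := hm
  let : Max A := ⟨fun a b => funMap joinSymb ![a, b]⟩
  let : Min A := ⟨fun a b => funMap meetSymb ![a, b]⟩
  let lat : Lattice A := Lattice.mk' (fun a b => h2 a b a) h4 (fun a b => h1 a b a) h3
    (fun a b => h6 a b a) (fun a b => h5 a b a)
  refine ⟨lat, ?_⟩
  ext n f x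
  · cases f
    · exact congrArg (funMap meetSymb) (funext fun i => by fin_cases i <;> rfl)
    · exact congrArg (funMap joinSymb) (funext fun i => by fin_cases i <;> rfl)
  · exact f.elim

/-! ### The zigzag operation and its fixed point system -/

/-- The operation `s ↦ s ∨ (a ∧ (b ∨ (c ∧ (d ∨ s))))` on terms. -/
def zigzagTerm {α : Type} (a b c d s : latticeLanguage.Term α) : latticeLanguage.Term α :=
  join s (meet a (join b (meet c (join d s))))

/-- The operation `x ↦ x ⊔ (a ⊓ (b ⊔ (c ⊓ (d ⊔ x))))` in a lattice. -/
def zigzag {A : Type*} [Lattice A] (a b c d x : A) : A :=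
  x ⊔ (a ⊓ (b ⊔ (c ⊓ (d ⊔ x))))

theorem zigzag_mono {A : Type*} [Lattice A] (a b c d : A) : Monotone (zigzag a b c d) := by
  intro x y h
  unfold zigzag
  gcongr

theorem le_zigzag {A : Type*} [Lattice A] (a b c d x : A) : x ≤ zigzag a b c d x := le_sup_left

/-- The iterates of the zigzag operation, starting from the variable `0`. -/
def iterateTerm : ℕ → latticeLanguage.Term (Fin 6)
  | 0 => Term.var 0
  | n + 1 => zigzagTerm (Term.var 2) (Term.var 3) (Term.var 4) (Term.var 5) (iterateTerm n)

/-- The equation saying that the `n`-th iterate lies below the variable `1`. -/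
def iterateBound (n : ℕ) : Equation latticeLanguage (Fin 6) :=
  (join (iterateTerm n) (Term.var 1), Term.var 1)

/-- The equations saying that the additional variable is a fixed point of the zigzag operation
between the variables `0` and `1`. -/
def fixpointEquations : Set (Equation latticeLanguage (Unit ⊕ Fin 6)) :=
  {(join (Term.var (Sum.inr 0)) (Term.var (Sum.inl ())), Term.var (Sum.inl ())),
    (join (Term.var (Sum.inl ())) (Term.var (Sum.inr 1)), Term.var (Sum.inr 1)),
    (zigzagTerm (Term.var (Sum.inr 2)) (Term.var (Sum.inr 3)) (Term.var (Sum.inr 4))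
      (Term.var (Sum.inr 5)) (Term.var (Sum.inl ())), Term.var (Sum.inl ()))}

theorem finite_fixpointEquations : fixpointEquations.Finite := by
  simp [fixpointEquations]

section Lattice

attribute [local instance] latticeStructure

variable {A : Type*} [Lattice A]

theorem realize_iterateTerm (v : Fin 6 → A) (n : ℕ) :
    (iterateTerm n).realize v = (zigzag (v 2) (v 3) (v 4) (v 5))^[n] (v 0) := by
  induction n with
  | zero => rfl
  | succ n ih =>
    rw [Function.iterate_succ_apply', ← ih]
    rfl

theorem holds_iterateBound (v : Fin 6 → A) (n : ℕ) :
    (iterateBound n).Holds v ↔ (zigzag (v 2) (v 3) (v 4) (v 5))^[n] (v 0) ≤ v 1 := by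
  rw [← realize_iterateTerm, ← sup_eq_right]
  rfl

theorem holds_iterateBound_vec (x y a b c d : A) (n : ℕ) :
    (iterateBound n).Holds ![x, y, a, b, c, d] ↔ (zigzag a b c d)^[n] x ≤ y :=
  holds_iterateBound _ n

theorem holds_fixpointEquations (v : Unit ⊕ Fin 6 → A) :
    (∀ e ∈ fixpointEquations, e.Holds v) ↔
      v (Sum.inr 0) ≤ v (Sum.inl ()) ∧ v (Sum.inl ()) ≤ v (Sum.inr 1) ∧
        zigzag (v (Sum.inr 2)) (v (Sum.inr 3)) (v (Sum.inr 4)) (v (Sum.inr 5)) (v (Sum.inl ())) =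
          v (Sum.inl ()) := by
  simp only [fixpointEquations, Set.mem_insert_iff, Set.mem_singleton_iff, forall_eq_or_imp,
    forall_eq]
  rw [← sup_eq_right, ← sup_eq_right]
  rfl

end Lattice

/-- A fixed point between the variables `0` and `1` bounds all iterates. -/
theorem iterateBound_of_fixpointEquations {A : Type*} [latticeLanguage.Structure A]
    (hA : lattices.IsMember A) (v : Unit ⊕ Fin 6 → A) (hv : ∀ e ∈ fixpointEquations, e.Holds v)
    (n : ℕ) : (iterateBound n).Holds (v ∘ Sum.inr) := by
  obtain ⟨lat, rfl⟩ := exists_lattice_of_isMember hA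
  obtain ⟨h0, h1, h2⟩ := (holds_fixpointEquations v).1 hv
  refine (holds_iterateBound _ n).2 (le_trans ?_ h1)
  have h := (zigzag_mono (v (Sum.inr 2)) (v (Sum.inr 3)) (v (Sum.inr 4)) (v (Sum.inr 5))).iterate n
    h0
  rwa [Function.iterate_fixed h2] at h

/-! ### Fixed points in the ideal lattice -/

section Ideal

open Order

variable {A : Type*} [Lattice A]

/-- The embedding of a lattice into the lattice of its ideals. -/
def principalHom (A : Type*) [Lattice A] [Nonempty A] : LatticeHom A (Ideal A) where
  toFun := Ideal.principal
  map_sup' a b := by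
    refine SetLike.ext fun x => Iff.trans ?_ Ideal.mem_sup.symm
    exact ⟨fun h => ⟨a, Ideal.mem_principal_self, b, Ideal.mem_principal_self, h⟩,
      fun ⟨i, hi, j, hj, h⟩ => h.trans (sup_le_sup hi hj)⟩
  map_inf' a b := by
    exact SetLike.ext fun x => le_inf_iff

theorem principalHom_injective [Nonempty A] : Function.Injective (principalHom A) := by
  intro a b h
  have h' : Ideal.principal a = Ideal.principal b := h
  apply le_antisymm
  · exact Ideal.principal_le_iff.1 h'.le
  · exact Ideal.principal_le_iff.1 h'.ge

/-- The ideal generated by an ascending sequence. -/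
def chainIdeal (s : ℕ → A) (hs : Monotone s) : Ideal A where
  carrier := {x | ∃ n, x ≤ s n}
  lower' := fun _ _ hba ⟨n, hn⟩ => ⟨n, hba.trans hn⟩
  nonempty' := ⟨s 0, 0, le_rfl⟩
  directed' := by
    rintro x ⟨m, hm⟩ y ⟨n, hn⟩
    exact ⟨s (max m n), ⟨_, le_rfl⟩, hm.trans (hs (le_max_left _ _)),
      hn.trans (hs (le_max_right _ _))⟩

theorem mem_chainIdeal {s : ℕ → A} {hs : Monotone s} {x : A} :
    x ∈ chainIdeal s hs ↔ ∃ n, x ≤ s n := Iff.rfl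

/-- The ideal generated by the iterates of the zigzag operation is a fixed point. -/
theorem zigzag_chainIdeal (a b c d x : A)
    (hs : Monotone fun n => (zigzag a b c d)^[n] x) :
    zigzag (Ideal.principal a) (Ideal.principal b) (Ideal.principal c) (Ideal.principal d)
      (chainIdeal _ hs) = chainIdeal _ hs := by
  refine le_antisymm (fun y hy => ?_) (le_zigzag _ _ _ _ _)
  simp only [zigzag, Ideal.mem_sup, mem_chainIdeal] at hy
  obtain ⟨i, ⟨m, hm⟩, j, ⟨hja, k, hkb, l, ⟨hlc, p, hpd, q, ⟨n, hn⟩, hl⟩, hj⟩, hy⟩ := hy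
  -- Membership involves only two elements of the chain ideal, both below stage `max m n`; one more
  -- application of the operation absorbs the whole expression.
  refine ⟨max m n + 1, hy.trans ?_⟩
  change _ ≤ (zigzag a b c d)^[max m n + 1] x
  rw [Function.iterate_succ_apply']
  refine sup_le_sup (hm.trans (hs (le_max_left _ _))) (le_inf hja (hj.trans (sup_le_sup hkb
    (le_inf hlc (hl.trans (sup_le_sup hpd (hn.trans (hs (le_max_right _ _)))))))))

end Ideal

/-- If all iterates are bounded by the value of the variable `1`, then there is a fixed point below
this bound in some larger lattice. -/
theorem exists_fixpoint_extension {A : Type u} [latticeLanguage.Structure A]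
    (hA : lattices.IsMember A) (v : Fin 6 → A) (hv : ∀ n, (iterateBound n).Holds v) :
    ∃ (C : Type u) (_ : latticeLanguage.Structure C) (f : A ↪[latticeLanguage] C) (x : C),
      lattices.IsMember C ∧ Nonempty C ∧
        ∀ e ∈ fixpointEquations, e.Holds (Sum.elim (fun _ => x) (f ∘ v)) := by
  obtain ⟨lat, rfl⟩ := exists_lattice_of_isMember hA
  have : Nonempty A := ⟨v 0⟩
  have hs : Monotone fun n => (zigzag (v 2) (v 3) (v 4) (v 5))^[n] (v 0) :=
    monotone_nat_of_le_succ fun n => by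
      rw [Function.iterate_succ_apply']
      exact le_zigzag _ _ _ _ _
  refine ⟨Order.Ideal A, latticeStructure _,
    embeddingOfLatticeHom (principalHom A) principalHom_injective, chainIdeal _ hs,
    isMember_lattices _, ⟨chainIdeal _ hs⟩, ?_⟩
  refine (holds_fixpointEquations _).2 ⟨?_, ?_, zigzag_chainIdeal _ _ _ _ _ hs⟩
  · exact Order.Ideal.principal_le_iff.2 ⟨0, le_rfl⟩
  · rintro y ⟨n, hn⟩
    exact hn.trans ((holds_iterateBound v n).1 (hv n))

theorem iterate_zigzag_up {A : Type*} [Lattice A] (a b c d x : A) (n : ℕ) :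
    (zigzag (ULift.up.{u} a) (ULift.up b) (ULift.up c) (ULift.up d))^[n] (ULift.up x) =
      ULift.up ((zigzag a b c d)^[n] x) := by
  induction n with
  | zero => rfl
  | succ n ih =>
    rw [Function.iterate_succ_apply', Function.iterate_succ_apply', ih]
    rfl

/-! ### Strictly increasing iterates among subgroups of `ℚ × ℚ` -/

section Subgroups

/-- The subgroup `2⁻ᵏℤ × 0` of `ℚ × ℚ`. -/
def dyadicSubgroup (k : ℕ) : AddSubgroup (ℚ × ℚ) where
  carrier := {p | p.2 = 0 ∧ ∃ m : ℤ, p.1 * 2 ^ k = m}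
  zero_mem' := ⟨rfl, 0, by simp⟩
  add_mem' := by
    rintro p q ⟨hp, m, hm⟩ ⟨hq, n, hn⟩
    exact ⟨by simp [hp, hq], m + n, by push_cast; rw [← hm, ← hn, ← add_mul]; rfl⟩
  neg_mem' := by
    rintro p ⟨hp, m, hm⟩
    exact ⟨by simp [hp], -m, by push_cast; rw [← hm, ← neg_mul]; rfl⟩

/-- The line `r x = s y` in `ℚ × ℚ`. -/
def lineSubgroup (r s : ℚ) : AddSubgroup (ℚ × ℚ) where
  carrier := {p | r * p.1 = s * p.2}
  zero_mem' := by simp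
  add_mem' := by
    intro p q hp hq
    simp only [Set.mem_ofPred_eq, Prod.fst_add, Prod.snd_add] at *
    linarith
  neg_mem' := by
    intro p hp
    simp only [Set.mem_ofPred_eq, Prod.fst_neg, Prod.snd_neg] at *
    linarith

theorem mem_lineSubgroup {r s : ℚ} {p : ℚ × ℚ} :
    p ∈ lineSubgroup r s ↔ r * p.1 = s * p.2 := Iff.rfl

theorem dyadicSubgroup_le_succ (k : ℕ) : dyadicSubgroup k ≤ dyadicSubgroup (k + 1) := by
  rintro p ⟨hp, m, hm⟩
  exact ⟨hp, m * 2, by push_cast; rw [← hm]; ring⟩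

/-- Two projections compose to halving: `(2x, 0)` moves along the line `x = 2y` to `(0, -x)` on the
vertical axis, and from there along the diagonal to `(x, 0)` on the horizontal axis. -/
theorem zigzag_dyadicSubgroup (k : ℕ) :
    zigzag (lineSubgroup 0 1) (lineSubgroup 1 1) (lineSubgroup 1 0) (lineSubgroup 1 2)
      (dyadicSubgroup k) = dyadicSubgroup (k + 1) := by
  apply le_antisymm
  · refine sup_le (dyadicSubgroup_le_succ k) ?_
    rintro ⟨x, y⟩ ⟨hy, hxy⟩
    obtain ⟨⟨e1, e2⟩, he, ⟨f1, f2⟩, ⟨hf, hfg⟩, hef⟩ := AddSubgroup.mem_sup.1 hxy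
    obtain ⟨⟨g1, g2⟩, hg, ⟨h1, h2⟩, ⟨hh, m, hm⟩, hgh⟩ := AddSubgroup.mem_sup.1 hfg
    change 0 * x = 1 * y at hy
    change 1 * f1 = 0 * f2 at hf
    simp only [Prod.mk_add_mk, Prod.mk.injEq, mem_lineSubgroup] at *
    obtain ⟨hef1, hef2⟩ := hef
    obtain ⟨hgh1, hgh2⟩ := hgh
    refine ⟨by linarith, m, ?_⟩
    have : h1 = 2 * x := by linarith
    rw [← hm, this]
    ring
  · rintro ⟨x, y⟩ ⟨hy, m, hm⟩
    simp only at hy hm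
    subst hy
    refine AddSubgroup.mem_sup_right ⟨by simp [mem_lineSubgroup], AddSubgroup.mem_sup.2
      ⟨(x, x), by simp [mem_lineSubgroup], (0, -x), ⟨by simp [mem_lineSubgroup],
        AddSubgroup.mem_sup.2 ⟨(-2 * x, -x), by simp [mem_lineSubgroup], (2 * x, 0),
          ⟨rfl, m, ?_⟩, by simp⟩⟩, by simp⟩⟩
    rw [← hm]
    ring

theorem not_dyadicSubgroup_succ_le (k : ℕ) : ¬ dyadicSubgroup (k + 1) ≤ dyadicSubgroup k := by
  intro h
  have h1 : ((1 / 2 ^ (k + 1), 0) : ℚ × ℚ) ∈ dyadicSubgroup (k + 1) := ⟨rfl, 1, by simp⟩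
  obtain ⟨-, m, hm⟩ := h h1
  have h2 : (1 : ℚ) = 2 * m := by
    rw [← hm, pow_succ]
    field_simp
  have h3 : (1 : ℤ) = 2 * m := by exact_mod_cast h2
  omega

theorem iterate_zigzag_dyadicSubgroup (n : ℕ) :
    (zigzag (lineSubgroup 0 1) (lineSubgroup 1 1) (lineSubgroup 1 0) (lineSubgroup 1 2))^[n]
      (dyadicSubgroup 0) = dyadicSubgroup n := by
  induction n with
  | zero => rfl
  | succ n ih => rw [Function.iterate_succ_apply', ih, zigzag_dyadicSubgroup]

end Subgroups

/-- There is a lattice with assignments for which any given finite number of iterates, but not all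
of them, are bounded by the value of the variable `1`. -/
theorem exists_bounded_iterates : ∃ (G : Type u) (_ : latticeLanguage.Structure G)
    (w : ℕ → Fin 6 → G), lattices.IsMember G ∧
      (∀ k n, n ≤ k → (iterateBound n).Holds (w k)) ∧
      ∀ k, ¬ (iterateBound (k + 1)).Holds (w k) := by
  have key (n : ℕ) : (zigzag (ULift.up.{u} (lineSubgroup 0 1)) (ULift.up (lineSubgroup 1 1))
      (ULift.up (lineSubgroup 1 0)) (ULift.up (lineSubgroup 1 2)))^[n]
        (ULift.up (dyadicSubgroup 0)) = ULift.up (dyadicSubgroup n) := by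
    rw [iterate_zigzag_up, iterate_zigzag_dyadicSubgroup]
  refine ⟨ULift.{u} (AddSubgroup (ℚ × ℚ)), latticeStructure _,
    fun k => ![⟨dyadicSubgroup 0⟩, ⟨dyadicSubgroup k⟩, ⟨lineSubgroup 0 1⟩, ⟨lineSubgroup 1 1⟩,
      ⟨lineSubgroup 1 0⟩, ⟨lineSubgroup 1 2⟩], isMember_lattices _, fun k n h => ?_, fun k h => ?_⟩
  · rw [holds_iterateBound_vec, key, ULift.up_le]
    exact monotone_nat_of_le_succ dyadicSubgroup_le_succ h
  · rw [holds_iterateBound_vec, key, ULift.up_le] at h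
    exact not_dyadicSubgroup_succ_le k h

/-! ### No finite set of consequences suffices -/

/-- In an ultrapower along a nonprincipal ultrafilter on `ℕ`, a family of assignments which
eventually satisfies each equation of a set gives an assignment satisfying the whole set. -/
theorem holds_hyperfilter_of_eventually {L : FirstOrder.Language.{0, 0}} {α : Type} {N : Type u}
    [L.Structure N] [Nonempty N] (e : Equation L α) (w : ℕ → α → N)
    (h : ∀ᶠ k in Filter.atTop, e.Holds (w k)) :
    e.Holds fun a => Equation.productMk (M := fun _ => N) (Filter.hyperfilter ℕ) fun k => w k a :=
  (e.holds_ultraproduct _ _).2 (Nat.hyperfilter_le_atTop h)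

/-- No finite set of consequences of the fixed point equations, in the variables other than the
fixed point, implies the bounds on all iterates. -/
theorem exists_not_iterateBound {E : Set (Equation latticeLanguage (Fin 6))} (hE : E.Finite)
    (hcons : ∀ e ∈ E, ∀ (A : Type u) [latticeLanguage.Structure A], lattices.IsMember A →
      ∀ v : Unit ⊕ Fin 6 → A, (∀ d ∈ fixpointEquations, d.Holds v) → e.Holds (v ∘ Sum.inr)) :
    ∃ (G : Type u) (_ : latticeLanguage.Structure G) (v : Fin 6 → G), lattices.IsMember G ∧
      (∀ e ∈ E, e.Holds v) ∧ ∃ n, ¬ (iterateBound n).Holds v := by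
  obtain ⟨G, _, w, hG, hw, hw'⟩ := exists_bounded_iterates.{u}
  have : Nonempty G := ⟨w 0 0⟩
  -- For each `n` the bound holds at all `k ≥ n`, so the ultrapower satisfies every bound and has an
  -- extension containing a fixed point.
  obtain ⟨C, _, f, x, hC, -, hx⟩ := exists_fixpoint_extension
    (Variety.IsMember.ultraproduct (Filter.hyperfilter ℕ) fun _ => hG)
    (fun a => Equation.productMk (M := fun _ => G) (Filter.hyperfilter ℕ) fun k => w k a)
    fun n => holds_hyperfilter_of_eventually _ w
      (Filter.eventually_atTop.2 ⟨n, fun k hk => hw k n hk⟩)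
  -- Equations descend from the extension to the ultrapower; finiteness of `E` then yields one index
  -- serving all of `E`.
  have h : ∀ᶠ k in (Filter.hyperfilter ℕ : Filter ℕ), ∀ e ∈ E, e.Holds (w k) := by
    rw [Filter.eventually_all_finite hE]
    intro e he
    exact (e.holds_ultraproduct (Filter.hyperfilter ℕ) fun a k => w k a).1
      ((e.holds_embedding f _).1 (hcons e he C hC _ hx))
  obtain ⟨k, hk⟩ := h.exists
  exact ⟨G, _, w k, hG, hk, k + 1, hw' k⟩

/-! ### The three negative results -/

theorem not_isCoherent_lattices : ¬ Variety.IsCoherent.{u} lattices := by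
  intro hcoh
  have hB := Variety.Presented.isPresentedBy.{u} lattices fixpointEquations
  set b : Unit ⊕ Fin 6 → Variety.Presented.{u} lattices fixpointEquations :=
    fun i => Variety.Presented.mk _ _ (Term.var i)
  set S := Substructure.closure latticeLanguage (Set.range (b ∘ Sum.inr))
  have hS := hcoh _ (hB.isFinitelyPresented finite_fixpointEquations) S
    (Substructure.fg_closure (Set.finite_range _))
  let a : Fin 6 → S := fun i => ⟨b (Sum.inr i), Substructure.subset_closure ⟨i, rfl⟩⟩
  have ha : S.subtype ∘ a = b ∘ Sum.inr := rfl
  have hgen : Substructure.closure latticeLanguage (Set.range a) = ⊤ := by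
    refine eq_top_iff.2 fun x _ => ?_
    obtain ⟨t, ht⟩ := Variety.exists_realize_eq_of_mem_closure (b ∘ Sum.inr) x.2
    have hx : t.realize a = x := S.subtype.injective (by
      rw [← HomClass.realize_term, ha, ht]
      rfl)
    rw [← hx]
    exact Term.realize_mem _ _ fun i => Substructure.subset_closure ⟨i, rfl⟩
  obtain ⟨E, hE, hEa, hEe⟩ := hS.exists_relations a hgen
  -- Every solution of the system is a homomorphic image of the generators `b`, so relations between
  -- the six parameters in `S` are consequences of the system.
  obtain ⟨G, _, v, hG, hv, n, hn⟩ := exists_not_iterateBound.{u} hE fun e he A _ hA v hv => by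
    obtain ⟨f, hf⟩ := hB.lift A hA v hv
    have hfv : v ∘ Sum.inr = f ∘ (b ∘ Sum.inr) := funext fun i => (hf (Sum.inr i)).symm
    rw [hfv, ← ha]
    exact ((e.holds_embedding S.subtype a).2 (hEa e he)).map f
  refine hn (hEe _ ?_ G hG v hv)
  rw [← Equation.holds_embedding _ S.subtype, ha]
  exact iterateBound_of_fixpointEquations hB.mem b hB.holds n

theorem not_hasUniformDeductiveInterpolation_lattices :
    ¬ Variety.HasUniformDeductiveInterpolation.{u} lattices := by
  intro h
  obtain ⟨P, hP, hPe⟩ := h Unit (Fin 6) fixpointEquations finite_fixpointEquations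
  obtain ⟨G, _, v, hG, hv, n, hn⟩ := exists_not_iterateBound.{u} hP fun e he A _ hA v hv => by
    -- No extra variables are needed: `z` is empty here and below. Trivially `P` entails its own
    -- members, so they follow from the system.
    have h1 := (hPe Empty (e.rename Sum.inl)).2
      (fun B _ hB w hw => hw _ ⟨e, he, rfl⟩) A hA
      (Sum.elim (v ∘ Sum.inl) (Sum.elim (v ∘ Sum.inr) Empty.elim)) (by
        rintro _ ⟨d, hd, rfl⟩
        rw [Equation.holds_rename]
        convert hv d hd using 1
        ext (i | i) <;> rfl)
    rw [Equation.holds_rename, Equation.holds_rename] at h1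
    exact h1
  have h2 := (hPe Empty ((iterateBound n).rename Sum.inl)).1 (fun B _ hB w hw => by
    rw [Equation.holds_rename, Equation.holds_rename]
    exact iterateBound_of_fixpointEquations hB
      (w ∘ (Sum.map id Sum.inl : Unit ⊕ Fin 6 → Unit ⊕ (Fin 6 ⊕ Empty)))
      (fun d hd => (d.holds_rename _ _).1 (hw _ ⟨d, hd, rfl⟩)) n) G hG (Sum.elim v Empty.elim) (by
        rintro _ ⟨d, hd, rfl⟩
        rw [Equation.holds_rename]
        exact hv d hd)
  rw [Equation.holds_rename] at h2
  exact hn h2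

/-- The solvability of a finite system of equations is expressed by a formula. -/
theorem exists_formula_solvable {L : FirstOrder.Language.{0, 0}} {α β : Type} [Finite β]
    {E : Set (Equation L (β ⊕ α))} (hE : E.Finite) :
    ∃ φ : L.Formula α, ∀ (A : Type u) [L.Structure A] (v : α → A),
      φ.Realize v ↔ ∃ x : β → A, ∀ e ∈ E, e.Holds (Sum.elim x v) := by
  have := hE.to_subtype
  refine ⟨(Formula.iInf fun e : E =>
    (e.1.1.relabel Sum.swap).equal (e.1.2.relabel Sum.swap)).iExs β, fun A _ v => ?_⟩
  simp only [Formula.realize_iExs, Formula.realize_iInf, Formula.realize_equal,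
    Term.realize_relabel, Subtype.forall]
  refine exists_congr fun x => forall₂_congr fun e he => ?_
  have : (Sum.elim v x ∘ Sum.swap : β ⊕ α → A) = Sum.elim x v := by
    ext (i | i) <;> rfl
  rw [this]
  rfl

/-- The models of the first-order theory of lattices are lattices. -/
theorem isMember_of_model {N : Type u} [latticeLanguage.Structure N]
    (h : ∀ φ ∈ Variety.firstOrderTheory.{u} lattices, N ⊨ φ) : lattices.IsMember N := by
  intro e he v
  -- Reducing variables modulo 3 fixes `0`, `1`, `2`, hence loses nothing, and leaves finitely many
  -- variables to quantify in a sentence.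
  let g : ℕ → Fin 3 := fun n => Fin.ofNat 3 n
  let φ : latticeLanguage.Sentence :=
    Formula.iAlls (Fin 3) (((e.rename g).1.relabel Sum.inr).equal ((e.rename g).2.relabel Sum.inr))
  have hφ (A : Type u) [latticeLanguage.Structure A] :
      A ⊨ φ ↔ ∀ x : Fin 3 → A, (e.rename g).Holds x := by
    simp only [φ, Sentence.Realize, Formula.realize_iAlls, Formula.realize_equal,
      Term.realize_relabel]
    rfl
  have h1 := (hφ N).1 (h φ fun A _ _ hA => (hφ A).2 fun x => by
    rw [Equation.holds_rename]
    exact hA e he _) fun i => v i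
  simp only [lattices, Set.mem_insert_iff, Set.mem_singleton_iff] at he
  rw [Equation.holds_rename] at h1
  rcases he with rfl | rfl | rfl | rfl | rfl | rfl <;>
    simpa [Equation.Holds, meet, join, g] using h1

theorem not_exists_isModelCompletion_lattices : ¬ ∃ T : latticeLanguage.Theory,
    IsModelCompletion.{u} (Variety.firstOrderTheory.{u} lattices) T := by
  rintro ⟨T, hT⟩
  have hmodel (A : Type u) [latticeLanguage.Structure A] [Nonempty A] (hA : lattices.IsMember A) :
      A ⊨ Variety.firstOrderTheory.{u} lattices := ⟨fun φ hφ => hφ A hA⟩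
  have hmember (A : Type u) [latticeLanguage.Structure A] [Nonempty A] [A ⊨ T] :
      lattices.IsMember A := isMember_of_model fun φ hφ => (hT.extend φ hφ).realize_sentence A
  obtain ⟨G, _, w, hG, hw, hw'⟩ := exists_bounded_iterates.{u}
  have : Nonempty G := ⟨w 0 0⟩
  have := hmodel G hG
  obtain ⟨N, ⟨i⟩⟩ := hT.embed ⟨G⟩
  -- The ultrapower is taken of `N` rather than `G`, so that it is again a model of `T` and
  -- completeness can compare it with its own extension `N'`.
  let U := ((Filter.hyperfilter ℕ : Ultrafilter ℕ) : Filter ℕ).Product fun _ => (N : Type u)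
  let v : Fin 6 → U := fun a =>
    Equation.productMk (M := fun _ => (N : Type u)) (Filter.hyperfilter ℕ) fun k => i (w k a)
  have hUT : U ⊨ T := ⟨fun φ hφ => (Ultraproduct.sentence_realize φ).2
    (Filter.Eventually.of_forall fun _ => Theory.realize_sentence_of_mem T hφ)⟩
  have hU : lattices.IsMember U := hmember U
  have := hmodel U hU
  obtain ⟨C, _, f, x, hC, _, hx⟩ := exists_fixpoint_extension hU v fun n =>
    holds_hyperfilter_of_eventually _ (fun k a => i (w k a)) (Filter.eventually_atTop.2
      ⟨n, fun k hk => ((iterateBound n).holds_embedding i (w k)).2 (hw k n hk)⟩)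
  have := hmodel C hC
  obtain ⟨N', ⟨j⟩⟩ := hT.embed ⟨C⟩
  obtain ⟨φ, hφ⟩ := exists_formula_solvable.{u} finite_fixpointEquations
  have h1 : φ.Realize ((j.comp f) ∘ v) := by
    refine (hφ N' _).2 ⟨fun _ => j x, fun e he => ?_⟩
    convert (e.holds_embedding j _).2 (hx e he) using 1
    ext (a | a) <;> rfl
  -- Over the diagram of `U`, solvability in `N'` transfers to `U`; Łoś's theorem then gives a
  -- solution in `N` at some index `k`, where bound `k + 1` fails.
  have h2 := (hT.complete ⟨U⟩ ⟨U⟩ N' (Embedding.refl _ U) (j.comp f) 6 φ v).2 h1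
  obtain ⟨y, hy⟩ := (hφ U v).1 h2
  obtain ⟨z, hz⟩ := Equation.productMk_surjective _ (y ())
  have h3 : ∀ᶠ k in (Filter.hyperfilter ℕ : Filter ℕ), ∀ e ∈ fixpointEquations,
      e.Holds (Sum.elim (fun _ => z k) fun a => i (w k a)) := by
    rw [Filter.eventually_all_finite finite_fixpointEquations]
    intro e he
    have h4 := (e.holds_ultraproduct (Filter.hyperfilter ℕ) (M := fun _ => (N : Type u))
      (Sum.elim (fun _ => z) fun a k => i (w k a))).1 (by
        convert hy e he using 1
        ext (a | a)
        · exact hz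
        · rfl)
    filter_upwards [h4] with k hk
    convert hk using 1
    ext (a | a) <;> rfl
  obtain ⟨k, hk⟩ := h3.exists
  exact hw' k (((iterateBound (k + 1)).holds_embedding i (w k)).1
    (iterateBound_of_fixpointEquations (hmember N) _ hk (k + 1)))

end UniversalAlgebra

theorem corollary5p14 :
    ¬ UniversalAlgebra.Variety.IsCoherent.{u} UniversalAlgebra.lattices ∧
    ¬ UniversalAlgebra.Variety.HasUniformDeductiveInterpolation.{u} UniversalAlgebra.lattices ∧
    ¬ ∃ T : UniversalAlgebra.latticeLanguage.Theory,
        UniversalAlgebra.IsModelCompletion.{u}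
          (UniversalAlgebra.Variety.firstOrderTheory.{u} UniversalAlgebra.lattices) T :=
  ⟨UniversalAlgebra.not_isCoherent_lattices,
    UniversalAlgebra.not_hasUniformDeductiveInterpolation_lattices,
    UniversalAlgebra.not_exists_isModelCompletion_lattices⟩
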